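/- Let $\tau\in\mathbb{C}$ with $\operatorname{Im}\tau>0$, put $q^{s}:=e^{2\pi i\tau s}$ for real $s$ (so $q=e^{2\pi i\tau}$), $J_m:=\prod_{i\ge 1}(1-q^{mi})$, $\eta(\tau):=q^{1/24}\prod_{n\ge1}(1-q^n)$, and for $x,y\in\mathbb{C}\setminus\{0\}$ let $$f_{a,b,c}(x,y,q):=\Big(\sum_{r,s\ge 0}-\sum_{r,s<0}\Big)(-1)^{r+s}x^ry^sq^{a\binom r2+brs+c\binom s2}\qquad (r,s\in\mathbb{Z}).$$ Let $c_{11}^{11}(\tau)$ be the level-$2$ string function of type $A_1^{(1)}$ with $\Lambda=\lambda=\Lambda_0+\Lambda_1$, in its Kac–Peterson form $$c_{11}^{11}(\tau)=\frac1{\eta(\tau)^3}\sum_{(x,y)}\mathrm{sg}(x)\,q^{4x^2-2y^2},$$ where the sum runs over all $(x,y)\in\mathbb{R}^2$ with $-|x|<y\le|x|$ such that $(x,y)$ or $(\tfrac12-x,\tfrac12+y)$ lies in $(\tfrac14,\tfrac14)+\mathbb{Z}^2$, and $\mathrm{sg}(x)=1$ for $x\ge0$, $\mathrm{sg}(x)=-1$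 for $x<0$. Then the double sums below converge absolutely, and $$f_{2,2,1}(q^2,q,q)=J_1J_2 .$$ Moreover $\eta(\tau)^3c_{11}^{11}(\tau)=q^{1/8}f_{2,2,1}(q^2,q,q)$, so that this identity is equivalent to the Kac–Peterson evaluation, which therefore holds as well: $$c_{11}^{11}(\tau)=\eta(\tau)^{-2}\eta(2\tau).$$ -/

import Mathlib

open UpperHalfPlane

noncomputable section

namespace HeckeString

/-- The nome `q = e^{2π i τ}`. -/
def nome (τ : ℂ) : ℂ := Complex.exp (2 * Real.pi * Complex.I * τ)

/-- The binomial coefficient `r (r - 1) / 2` for an arbitrary integer `r` (the division is exact). -/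
def binom2 (r : ℤ) : ℤ := r * (r - 1) / 2

/-- `J_m = ∏_{i ≥ 1} (1 - q^{m i})`. -/
def J (m : ℕ) (q : ℂ) : ℂ := ∏' i : ℕ, (1 - q ^ (m * (i + 1)))

/-- The general term `(-1)^{r+s} x^r y^s q^{a C(r,2) + b r s + c C(s,2)}` of a Hecke-type
double sum. -/
def heckeTerm (a b c : ℤ) (x y q : ℂ) (p : ℤ × ℤ) : ℂ :=
  (-1) ^ (p.1 + p.2) * x ^ p.1 * y ^ p.2 *
    q ^ (a * binom2 p.1 + b * p.1 * p.2 + c * binom2 p.2)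

/-- The pairs `(r, s)` with `r, s ≥ 0`. -/
def nonnegQuadrant : Set (ℤ × ℤ) := {p | 0 ≤ p.1 ∧ 0 ≤ p.2}

/-- The pairs `(r, s)` with `r, s < 0`. -/
def negQuadrant : Set (ℤ × ℤ) := {p | p.1 < 0 ∧ p.2 < 0}

/-- The Hecke-type double sum `f_{a,b,c}(x, y, q)`: the sum over `r, s ≥ 0` minus the sum over
`r, s < 0`. -/
def heckeF (a b c : ℤ) (x y q : ℂ) : ℂ :=
  (∑' p : nonnegQuadrant, heckeTerm a b c x y q p) -
    ∑' p : negQuadrant, heckeTerm a b c x y q p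

/-- `sg(x) = 1` for `x ≥ 0` and `-1` for `x < 0`. -/
def sg (x : ℝ) : ℝ := if 0 ≤ x then 1 else -1

/-- Membership in the translated lattice `((ℓ + 1) / (2 (N + 2)), m / (2 N)) + ℤ²`. -/
def inShiftedLattice (N l m : ℕ) (x y : ℝ) : Prop :=
  ∃ a b : ℤ, x = ((l : ℝ) + 1) / (2 * ((N : ℝ) + 2)) + a ∧ y = (m : ℝ) / (2 * (N : ℝ)) + b

/-- The index set of the Kac–Peterson double sum at level `N`. -/
def kpIndex (N l m : ℕ) : Set (ℝ × ℝ) :=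
  {p | -|p.1| < p.2 ∧ p.2 ≤ |p.1| ∧
    (inShiftedLattice N l m p.1 p.2 ∨ inShiftedLattice N l m (1 / 2 - p.1) (1 / 2 + p.2))}

/-- The general term `sg(x) q^{(N+2) x² - N y²}` with `q^s = e^{2π i τ s}` for real `s`. -/
def kpTerm (N : ℕ) (τ : ℂ) (p : ℝ × ℝ) : ℂ :=
  (sg p.1 : ℂ) * Complex.exp (2 * Real.pi * Complex.I * τ *
    ((((N : ℝ) + 2) * p.1 ^ 2 - (N : ℝ) * p.2 ^ 2 : ℝ) : ℂ))

/-- The level-`N` string function `c_{N-m,m}^{N-ℓ,ℓ}(τ)` of type `A_1^{(1)}`, in the form of the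
Kac–Peterson indefinite double sum divided by `η(τ)^3`. -/
def stringFunction (N l m : ℕ) (τ : ℂ) : ℂ :=
  (ModularForm.eta τ ^ 3)⁻¹ * ∑' p : kpIndex N l m, kpTerm N τ p

end HeckeString

end

/-!
Both double sums are the sum of `(-1)^n q^{n(n+1) - j(j+1)/2}` over the wedge `|j| ≤ n`: the
quadrants `r, s ≥ 0` and `r, s < 0` give its halves `j ≥ 0` and `j < 0`, and the Kac–Peterson points
are `x = ±(2n+1)/4`, `y = (2j+1)/4`.

With `D_n(z) = ∑_{|j| ≤ n} z^j`, the Jacobi triple product divided by `1 - z⁻¹` reads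
`∑_{n ≥ 0} (-1)^n q^{n(n+1)/2} D_n(z) = ∏_{i ≥ 1} (1 - q^i) (1 - z q^i) (1 - z⁻¹ q^i)`.
It is the limit of a finite identity that follows from the three-term recursion of `D_n`. The
right-hand side is `J₁³` at `z = 1` and vanishes at `z = q^a` for `a ≠ 0`; at `z = -1` it gives
Gauss' evaluation `ψ := ∑_{n ≥ 0} q^{n(n+1)/2} = J₂² / J₁`.

For every integer `j`, also `∑_{a ∈ ℤ} q^{(2a+j)(2a+j+1)/2} = ψ`. Multiplying the wedge sum by `ψ`
in this form and summing over the wedge first leaves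
`∑_a q^{a(2a+1)} ∑_n (-1)^n q^{n(n+1)} D_n(q^{2a})`, of which only the term `a = 0` survives, with
value `J₂³`. So the wedge sum is `J₂³ / ψ = J₁ J₂`.
-/

namespace HeckeString

open Filter Topology Finset

theorem two_mul_binom2 (r : ℤ) : 2 * binom2 r = r * (r - 1) :=
  Int.mul_ediv_cancel' (Int.even_mul_pred_self r).two_dvd

theorem binom2_add_one (r : ℤ) : binom2 (r + 1) = binom2 r + r := by
  linarith [two_mul_binom2 r, two_mul_binom2 (r + 1)]

theorem binom2_neg (r : ℤ) : binom2 (-r) = binom2 (r + 1) := by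
  linarith [two_mul_binom2 (-r), two_mul_binom2 (r + 1)]

noncomputable section FiniteIdentity

variable {K : Type*} [Field K]

/-- The `q`-Pochhammer symbol `(q; q)_n = ∏_{i=1}^n (1 - q^i)`. -/
def qPoch (q : K) (n : ℕ) : K := ∏ i ∈ range n, (1 - q ^ (i + 1))

/-- The reciprocal `1 / (q; q)_m`, which is `0` for `m < 0` so that the recursion
`invQPoch_sub_one` holds for all integers. -/
def invQPoch (q : K) (m : ℤ) : K := if m < 0 then 0 else (qPoch q m.toNat)⁻¹

/-- The Dirichlet kernel `∑_{|j| ≤ n} z^j`, as a Laurent polynomial in `z`. -/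
def dirichletKernel (z : K) (n : ℕ) : K := ∑ j ∈ Icc (-(n : ℤ)) n, z ^ j

/-- The coefficient of the `n`-th Dirichlet kernel in `∏_{i=1}^N (1 - z q^i) (1 - z⁻¹ q^i)`. It is
defined for all integers `n`, being odd under the reflection `n ↦ -1 - n`. -/
def kernelCoeff (q : K) (N : ℕ) (n : ℤ) : K :=
  (-1) ^ n * q ^ binom2 (n + 1) *
    (qPoch q (2 * N + 1) * invQPoch q (N - n) * invQPoch q (N + n + 1))

variable {q z : K}

theorem qPoch_succ (q : K) (n : ℕ) : qPoch q (n + 1) = qPoch q n * (1 - q ^ (n + 1)) :=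
  prod_range_succ _ _

theorem one_sub_pow_succ_ne_zero (hq : ¬IsOfFinOrder q) (n : ℕ) : 1 - q ^ (n + 1) ≠ 0 :=
  fun h => hq (isOfFinOrder_iff_pow_eq_one.2 ⟨n + 1, n.succ_pos, (sub_eq_zero.1 h).symm⟩)

theorem invQPoch_of_neg {m : ℤ} (hm : m < 0) : invQPoch q m = 0 := if_pos hm

theorem invQPoch_natCast (n : ℕ) : invQPoch q n = (qPoch q n)⁻¹ := by simp [invQPoch]

theorem invQPoch_sub_one (hq : ¬IsOfFinOrder q) (m : ℤ) :
    invQPoch q (m - 1) = (1 - q ^ m) * invQPoch q m := by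
  obtain hm | rfl | hm := lt_trichotomy m 0
  · rw [invQPoch_of_neg hm, invQPoch_of_neg (by omega), mul_zero]
  · rw [invQPoch_of_neg (by omega), zpow_zero, sub_self, zero_mul]
  · obtain ⟨n, rfl⟩ : ∃ n : ℕ, m = (n + 1 : ℕ) := ⟨(m - 1).toNat, by omega⟩
    rw [invQPoch_natCast, qPoch_succ, zpow_natCast, mul_inv, mul_left_comm,
      mul_inv_cancel₀ (one_sub_pow_succ_ne_zero hq n), mul_one, Nat.cast_succ,
      add_sub_cancel_right, invQPoch_natCast]

theorem dirichletKernel_zero (z : K) : dirichletKernel z 0 = 1 := by simp [dirichletKernel]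

theorem dirichletKernel_succ (z : K) (n : ℕ) :
    dirichletKernel z (n + 1) =
      dirichletKernel z n + z ^ ((n : ℤ) + 1) + z ^ (-((n : ℤ) + 1)) := by
  have hIcc : Icc (-((n + 1 : ℕ) : ℤ)) (n + 1 : ℕ) =
      insert (-((n : ℤ) + 1)) (insert ((n : ℤ) + 1) (Icc (-(n : ℤ)) n)) := by
    ext j; simp only [mem_Icc, mem_insert]; omega
  rw [dirichletKernel, hIcc, sum_insert (by simp; omega), sum_insert (by simp), dirichletKernel]
  ring

theorem dirichletKernel_one (z : K) : dirichletKernel z 1 = z + 1 + z⁻¹ := by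
  rw [dirichletKernel_succ, dirichletKernel_zero]
  simp [add_comm]

theorem dirichletKernel_neg_one (n : ℕ) : dirichletKernel (-1 : K) n = (-1) ^ n := by
  induction n with
  | zero => simp [dirichletKernel_zero]
  | succ n ih =>
    have hinv : (-1 : K) ^ (-((n : ℤ) + 1)) = (-1) ^ (n + 1) := by
      rw [← inv_zpow', inv_neg_one]; norm_cast
    have hpow : (-1 : K) ^ ((n : ℤ) + 1) = (-1) ^ (n + 1) := by norm_cast
    rw [dirichletKernel_succ, ih, hinv, hpow]
    ring

theorem dirichletKernel_add_two_add (hz : z ≠ 0) (n : ℕ) :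
    dirichletKernel z (n + 2) + dirichletKernel z n = (z + z⁻¹) * dirichletKernel z (n + 1) := by
  induction n with
  | zero =>
    rw [dirichletKernel_succ, dirichletKernel_one, dirichletKernel_zero]
    simp only [zpow_neg, Nat.cast_one, Int.reduceAdd]
    field_simp
    ring
  | succ n ih =>
    have h₁ := dirichletKernel_succ z n
    have h₂ := dirichletKernel_succ z (n + 1)
    have h₃ := dirichletKernel_succ z (n + 2)
    push_cast at h₂ h₃
    have hinc : (z + z⁻¹) * (z ^ (n + 1 + 1 : ℤ) + z ^ (-(n + 1 + 1) : ℤ)) =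
        z ^ (n + 2 + 1 : ℤ) + z ^ (-(n + 2 + 1) : ℤ) + z ^ (n + 1 : ℤ) + z ^ (-(n + 1) : ℤ) := by
      simp only [zpow_neg, zpow_add₀ hz, zpow_natCast, zpow_ofNat]
      field_simp
      ring
    linear_combination ih + h₃ + h₁ - (z + z⁻¹) * h₂ - hinc

/-- Summation by parts for the three-term recursion of the Dirichlet kernels. -/
theorem sum_range_neighbours_mul_dirichletKernel (hz : z ≠ 0) (c : ℤ → K) (hc : c (-1) = -c 0)
    (M : ℕ) :
    ∑ n ∈ range (M + 1), (c (n - 1) + c (n + 1)) * dirichletKernel z n =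
      (z + z⁻¹) * ∑ n ∈ range (M + 1), c n * dirichletKernel z n +
        c (M + 1) * dirichletKernel z M - c M * dirichletKernel z (M + 1) := by
  induction M with
  | zero => simp [hc, dirichletKernel_zero, dirichletKernel_one]; ring
  | succ M ih =>
    rw [sum_range_succ, ih, sum_range_succ _ (M + 1)]
    have h := dirichletKernel_add_two_add hz M
    push_cast
    rw [add_sub_cancel_right]
    linear_combination c (M + 1) * h

theorem kernelCoeff_neg_one (q : K) (N : ℕ) : kernelCoeff q N (-1) = -kernelCoeff q N 0 := by
  simp [kernelCoeff, binom2, mul_right_comm]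

theorem kernelCoeff_eq_zero {N : ℕ} {n : ℤ} (h : N < n) : kernelCoeff q N n = 0 := by
  rw [kernelCoeff, invQPoch_of_neg (by omega), mul_zero, zero_mul, mul_zero]

theorem kernelCoeff_zero_zero (hq : ¬IsOfFinOrder q) : kernelCoeff q 0 0 = 1 := by
  have h := one_sub_pow_succ_ne_zero hq 0
  have hcoeff : kernelCoeff q 0 0 = (1 - q ^ (0 + 1)) * (1 - q ^ (0 + 1))⁻¹ := by
    simp [kernelCoeff, binom2, invQPoch, qPoch]
  rw [hcoeff, mul_inv_cancel₀ h]

theorem kernelCoeff_succ (hq0 : q ≠ 0) (hq : ¬IsOfFinOrder q) (N : ℕ) (n : ℤ) :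
    kernelCoeff q (N + 1) n = (1 + q ^ (2 * (N + 1))) * kernelCoeff q N n -
      q ^ (N + 1) * (kernelCoeff q N (n - 1) + kernelCoeff q N (n + 1)) := by
  set α := invQPoch q (N + 1 - n) with hα
  set β := invQPoch q (N + n + 2) with hβ
  have hα₁ : invQPoch q (N - n) = (1 - q ^ (N + 1 - n : ℤ)) * α := by
    rw [hα, ← invQPoch_sub_one hq]; congr 1; ring
  have hα₂ : invQPoch q (N - (n + 1)) =
      (1 - q ^ (N - n : ℤ)) * ((1 - q ^ (N + 1 - n : ℤ)) * α) := by
    rw [← hα₁, ← invQPoch_sub_one hq]; congr 1; ring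
  have hβ₁ : invQPoch q (N + n + 1) = (1 - q ^ (N + n + 2 : ℤ)) * β := by
    rw [hβ, ← invQPoch_sub_one hq]; congr 1; ring
  have hβ₂ : invQPoch q (N + (n - 1) + 1) =
      (1 - q ^ (N + n + 1 : ℤ)) * ((1 - q ^ (N + n + 2 : ℤ)) * β) := by
    rw [← hβ₁, ← invQPoch_sub_one hq]; congr 1; ring
  have hpred : q ^ binom2 n = q ^ binom2 (n + 1) * (q ^ n)⁻¹ := by
    rw [binom2_add_one, zpow_add₀ hq0, mul_inv_cancel_right₀ (zpow_ne_zero n hq0)]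
  have hsucc : q ^ binom2 (n + 1 + 1) = q ^ binom2 (n + 1) * (q ^ n * q) := by
    rw [binom2_add_one (n + 1), zpow_add₀ hq0, zpow_add_one₀ hq0]
  have hneg : (-1 : K) ≠ 0 := neg_ne_zero.2 one_ne_zero
  simp only [kernelCoeff, Nat.cast_add, Nat.cast_one, sub_add_cancel, hpred, hsucc,
    show (N + 1 + n + 1 : ℤ) = N + n + 2 by ring, ← hα, ← hβ,
    show (N - (n - 1) : ℤ) = N + 1 - n by ring, show (N + (n + 1) + 1 : ℤ) = N + n + 2 by ring,
    hα₁, hα₂, hβ₁, hβ₂, show 2 * (N + 1) + 1 = 2 * N + 1 + 1 + 1 by ring, qPoch_succ,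
    zpow_sub₀ hneg, zpow_add₀ hneg, zpow_one]
  simp only [zpow_sub₀ hq0, zpow_add₀ hq0, zpow_natCast, zpow_ofNat]
  have := zpow_ne_zero n hq0
  field_simp
  ring

theorem prod_range_eq_sum_kernelCoeff (hq0 : q ≠ 0) (hq : ¬IsOfFinOrder q) (hz : z ≠ 0) (N : ℕ) :
    ∏ i ∈ range N, ((1 - z * q ^ (i + 1)) * (1 - z⁻¹ * q ^ (i + 1))) =
      ∑ n ∈ range (N + 1), kernelCoeff q N n * dirichletKernel z n := by
  induction N with
  | zero => simp [kernelCoeff_zero_zero hq, dirichletKernel_zero]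
  | succ N ih =>
    rw [prod_range_succ]
    set P := ∏ i ∈ range N, ((1 - z * q ^ (i + 1)) * (1 - z⁻¹ * q ^ (i + 1)))
    have hext : ∑ n ∈ range (N + 1 + 1), kernelCoeff q N n * dirichletKernel z n = P := by
      rw [sum_range_succ, kernelCoeff_eq_zero (by push_cast; omega), zero_mul, add_zero, ih]
    have hparts := sum_range_neighbours_mul_dirichletKernel hz (kernelCoeff q N)
      (kernelCoeff_neg_one q N) (N + 1)
    rw [hext, kernelCoeff_eq_zero (n := _ + 1) (by push_cast; omega),
      kernelCoeff_eq_zero (by push_cast; omega)] at hparts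
    simp only [kernelCoeff_succ hq0 hq, sub_mul, mul_assoc, sum_sub_distrib, ← mul_sum, hparts,
      hext]
    linear_combination P * q ^ (2 * (N + 1)) * mul_inv_cancel₀ hz

end FiniteIdentity

section TripleProduct

variable {q z : ℂ}

theorem not_isOfFinOrder_of_norm_lt_one (hq : ‖q‖ < 1) : ¬IsOfFinOrder q := fun h =>
  hq.ne h.norm_eq_one

theorem norm_sq_lt_one (hq : ‖q‖ < 1) : ‖q ^ 2‖ < 1 := by
  rw [norm_pow]; exact pow_lt_one₀ (norm_nonneg q) hq two_ne_zero

theorem J_eq_J_one_pow (m : ℕ) (q : ℂ) : J m q = J 1 (q ^ m) := by simp only [J, pow_mul, pow_one]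

theorem multipliable_one_sub_mul_pow (hq : ‖q‖ < 1) (z : ℂ) :
    Multipliable fun i : ℕ => 1 - z * q ^ (i + 1) := by
  have hsum : Summable fun i : ℕ => ‖-(z * q ^ (i + 1))‖ := by
    simpa only [norm_neg, norm_mul, norm_pow] using
      ((summable_nat_add_iff 1).2 (summable_geometric_of_lt_one (norm_nonneg q) hq)).mul_left ‖z‖
  simpa only [sub_eq_add_neg] using multipliable_one_add_of_summable hsum

theorem tendsto_prod_range_one_sub_mul_pow (hq : ‖q‖ < 1) (z : ℂ) :
    Tendsto (fun N => ∏ i ∈ range N, (1 - z * q ^ (i + 1))) atTop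
      (𝓝 (∏' i : ℕ, (1 - z * q ^ (i + 1)))) :=
  (multipliable_one_sub_mul_pow hq z).hasProd.tendsto_prod_nat

theorem tendsto_qPoch (hq : ‖q‖ < 1) : Tendsto (qPoch q) atTop (𝓝 (J 1 q)) := by
  have h := tendsto_prod_range_one_sub_mul_pow hq 1
  simp only [one_mul] at h
  simpa only [J, one_mul] using! h

theorem J_one_ne_zero (hq : ‖q‖ < 1) : J 1 q ≠ 0 := by
  have hfactor (i : ℕ) : 1 + -q ^ (i + 1) ≠ 0 := by
    rw [← sub_eq_add_neg]
    exact one_sub_pow_succ_ne_zero (not_isOfFinOrder_of_norm_lt_one hq) i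
  have hsum : Summable fun i : ℕ => ‖-q ^ (i + 1)‖ := by
    simpa only [norm_neg, norm_pow] using
      (summable_nat_add_iff 1).2 (summable_geometric_of_lt_one (norm_nonneg q) hq)
  simpa only [J, one_mul, sub_eq_add_neg] using tprod_one_add_ne_zero_of_summable hfactor hsum

theorem tendsto_invQPoch (hq : ‖q‖ < 1) : Tendsto (invQPoch q) atTop (𝓝 (J 1 q)⁻¹) := by
  have htoNat : Tendsto Int.toNat atTop atTop :=
    tendsto_atTop_atTop.2 fun b => ⟨b, fun m hm => by omega⟩
  refine (((tendsto_qPoch hq).inv₀ (J_one_ne_zero hq)).comp htoNat).congr' ?_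
  filter_upwards [eventually_ge_atTop 0] with m hm
  exact (if_neg hm.not_gt).symm

theorem exists_norm_qPoch_le (hq : ‖q‖ < 1) : ∃ C, ∀ n, ‖qPoch q n‖ ≤ C := by
  simpa using (Metric.isBounded_range_of_tendsto _ (tendsto_qPoch hq)).exists_norm_le

theorem exists_norm_invQPoch_le (hq : ‖q‖ < 1) : ∃ C, ∀ m, ‖invQPoch q m‖ ≤ C := by
  obtain ⟨C, hC⟩ := (Metric.isBounded_range_of_tendsto _
    ((tendsto_qPoch hq).inv₀ (J_one_ne_zero hq))).exists_norm_le
  refine ⟨C, fun m => ?_⟩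
  rcases lt_or_ge m 0 with hm | hm
  · rw [invQPoch_of_neg hm, norm_zero]
    exact (norm_nonneg _).trans (hC _ ⟨0, rfl⟩)
  · lift m to ℕ using hm
    rw [invQPoch_natCast]
    exact hC _ ⟨m, rfl⟩

theorem tendsto_kernelCoeff (hq : ‖q‖ < 1) (n : ℤ) :
    Tendsto (fun N => kernelCoeff q N n) atTop
      (𝓝 ((-1) ^ n * q ^ binom2 (n + 1) * (J 1 q)⁻¹)) := by
  have hodd : Tendsto (fun N : ℕ => 2 * N + 1) atTop atTop :=
    tendsto_atTop_atTop.2 fun b => ⟨b, fun N hN => by omega⟩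
  have hsub : Tendsto (fun N : ℕ => (N - n : ℤ)) atTop atTop :=
    tendsto_natCast_atTop_atTop.atTop_add tendsto_const_nhds
  have hadd : Tendsto (fun N : ℕ => (N + n + 1 : ℤ)) atTop atTop := by
    simp only [add_assoc]
    exact tendsto_natCast_atTop_atTop.atTop_add tendsto_const_nhds
  have h := ((((tendsto_qPoch hq).comp hodd).mul ((tendsto_invQPoch hq).comp hsub)).mul
    ((tendsto_invQPoch hq).comp hadd)).const_mul ((-1) ^ n * q ^ binom2 (n + 1))
  rwa [mul_inv_cancel₀ (J_one_ne_zero hq), one_mul] at h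

theorem exists_norm_kernelCoeff_le (hq : ‖q‖ < 1) :
    ∃ C, ∀ N n, ‖kernelCoeff q N n‖ ≤ ‖q‖ ^ binom2 (n + 1) * C := by
  obtain ⟨A, hA⟩ := exists_norm_qPoch_le hq
  obtain ⟨B, hB⟩ := exists_norm_invQPoch_le hq
  have hA0 : 0 ≤ A := (norm_nonneg _).trans (hA 0)
  have hB0 : 0 ≤ B := (norm_nonneg _).trans (hB 0)
  refine ⟨A * B * B, fun N n => ?_⟩
  simp only [kernelCoeff, norm_mul, norm_zpow, norm_neg, norm_one, one_zpow, one_mul]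
  gcongr
  exacts [hA _, hB _, hB _]

theorem norm_dirichletKernel_le (z : ℂ) (n : ℕ) :
    ‖dirichletKernel z n‖ ≤ dirichletKernel ‖z‖ n :=
  (norm_sum_le _ _).trans_eq (sum_congr rfl fun j _ => norm_zpow z j)

theorem dirichletKernel_nonneg {R : ℝ} (hR : 0 ≤ R) (n : ℕ) : 0 ≤ dirichletKernel R n :=
  sum_nonneg fun j _ => zpow_nonneg hR j

theorem dirichletKernel_le_pow {R : ℝ} (hR : 0 < R) (n : ℕ) :
    dirichletKernel R n ≤ (R + 1 + R⁻¹) ^ n := by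
  have hstep (n : ℕ) : dirichletKernel R (n + 1) ≤ (R + 1 + R⁻¹) * dirichletKernel R n := by
    cases n with
    | zero => rw [dirichletKernel_one, dirichletKernel_zero, mul_one]
    | succ n =>
      linarith [dirichletKernel_add_two_add hR.ne' n, dirichletKernel_nonneg hR.le n,
        dirichletKernel_nonneg hR.le (n + 1)]
  induction n with
  | zero => rw [dirichletKernel_zero, pow_zero]
  | succ n ih =>
    rw [pow_succ']
    exact (hstep n).trans (by gcongr)

theorem summable_zpow_binom2_mul_pow {r R : ℝ} (hr0 : 0 < r) (hr : r < 1) (hR : 0 < R) :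
    Summable fun n : ℕ => r ^ binom2 (n + 1) * R ^ n := by
  have hratio (n : ℕ) : ‖r ^ binom2 ((n + 1 : ℕ) + 1) * R ^ (n + 1)‖ / ‖r ^ binom2 (n + 1) * R ^ n‖
      = r ^ (n + 1) * R := by
    rw [Real.norm_of_nonneg (by positivity), Real.norm_of_nonneg (by positivity), binom2_add_one,
      zpow_add₀ hr0.ne', zpow_natCast]
    push_cast
    field_simp
    ring
  refine summable_of_ratio_test_tendsto_lt_one zero_lt_one
    (Eventually.of_forall fun n => by positivity) ?_
  simp_rw [hratio]
  simpa using ((tendsto_pow_atTop_nhds_zero_of_lt_one hr0.le hr).comp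
    (tendsto_add_atTop_nat 1)).mul_const R

theorem summable_zpow_binom2_mul_dirichletKernel {r R : ℝ} (hr0 : 0 < r) (hr : r < 1)
    (hR : 0 < R) : Summable fun n : ℕ => r ^ binom2 (n + 1) * dirichletKernel R n := by
  refine (summable_zpow_binom2_mul_pow hr0 hr (R := R + 1 + R⁻¹) (by positivity)).of_nonneg_of_le
    (fun n => mul_nonneg (by positivity) (dirichletKernel_nonneg hR.le n)) fun n => ?_
  gcongr
  exact dirichletKernel_le_pow hR n

/-- The Jacobi triple product divided by `1 - z⁻¹`, so that `z = 1` is allowed. -/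
theorem hasSum_zpow_binom2_mul_dirichletKernel (hq0 : q ≠ 0) (hq : ‖q‖ < 1) (hz : z ≠ 0) :
    HasSum (fun n : ℕ => (-1) ^ n * q ^ binom2 (n + 1) * dirichletKernel z n)
      (J 1 q * ((∏' i : ℕ, (1 - z * q ^ (i + 1))) * ∏' i : ℕ, (1 - z⁻¹ * q ^ (i + 1)))) := by
  obtain ⟨C, hC⟩ := exists_norm_kernelCoeff_le hq
  have hmajorant := summable_zpow_binom2_mul_dirichletKernel (norm_pos_iff.2 hq0) hq
    (norm_pos_iff.2 hz)
  have hseries := tendsto_tsum_of_dominated_convergence (𝓕 := atTop)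
    (f := fun (N n : ℕ) => kernelCoeff q N n * dirichletKernel z n)
    (g := fun n : ℕ => (-1) ^ n * q ^ binom2 (n + 1) * dirichletKernel z n * (J 1 q)⁻¹)
    (bound := fun n : ℕ => ‖q‖ ^ binom2 (n + 1) * dirichletKernel ‖z‖ n * C)
    (hmajorant.mul_right C)
    (fun n => by
      simpa only [zpow_natCast, mul_right_comm] using
        (tendsto_kernelCoeff hq n).mul_const (dirichletKernel z n))
    (Eventually.of_forall fun N n => by
      rw [norm_mul, mul_right_comm]
      gcongr
      exacts [(norm_nonneg _).trans (hC N n), hC N n, norm_dirichletKernel_le z n])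
  have hfinite (N : ℕ) : ∑' n : ℕ, kernelCoeff q N n * dirichletKernel z n =
      (∏ i ∈ range N, (1 - z * q ^ (i + 1))) * ∏ i ∈ range N, (1 - z⁻¹ * q ^ (i + 1)) := by
    rw [← prod_mul_distrib,
      prod_range_eq_sum_kernelCoeff hq0 (not_isOfFinOrder_of_norm_lt_one hq) hz,
      tsum_eq_sum fun n hn => ?_]
    rw [kernelCoeff_eq_zero (by simpa [Nat.succ_le_iff] using hn), zero_mul]
  have hproduct := (tendsto_prod_range_one_sub_mul_pow hq z).mul
    (tendsto_prod_range_one_sub_mul_pow hq z⁻¹)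
  have hlimit := tendsto_nhds_unique (hseries.congr hfinite) hproduct
  rw [← hlimit, tsum_mul_right, mul_left_comm, mul_inv_cancel₀ (J_one_ne_zero hq), mul_one]
  refine (Summable.of_norm_bounded hmajorant fun n => ?_).hasSum
  simp only [norm_mul, norm_pow, norm_neg, norm_one, one_pow, one_mul, norm_zpow]
  gcongr
  exact norm_dirichletKernel_le z n

theorem hasSum_zpow_binom2_mul_dirichletKernel_one (hq0 : q ≠ 0) (hq : ‖q‖ < 1) :
    HasSum (fun n : ℕ => (-1) ^ n * q ^ binom2 (n + 1) * dirichletKernel 1 n) (J 1 q ^ 3) := by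
  have h := hasSum_zpow_binom2_mul_dirichletKernel hq0 hq one_ne_zero
  simp only [inv_one, one_mul] at h
  simpa only [J, one_mul, pow_succ', pow_zero, mul_one] using h

theorem hasSum_zpow_binom2_mul_dirichletKernel_zpow (hq0 : q ≠ 0) (hq : ‖q‖ < 1) {a : ℤ}
    (ha : a ≠ 0) :
    HasSum (fun n : ℕ => (-1) ^ n * q ^ binom2 (n + 1) * dirichletKernel (q ^ a) n) 0 := by
  have hfactor {m : ℤ} (hm : m < 0) : ∏' i : ℕ, (1 - q ^ m * q ^ (i + 1)) = 0 := by
    refine tprod_of_exists_eq_zero ⟨(-m - 1).toNat, ?_⟩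
    rw [← zpow_natCast, ← zpow_add₀ hq0, sub_eq_zero,
      show m + ((-m - 1).toNat + 1 : ℕ) = 0 by omega, zpow_zero]
  convert hasSum_zpow_binom2_mul_dirichletKernel hq0 hq (zpow_ne_zero a hq0)
  rcases ha.lt_or_gt with ha | ha
  · rw [hfactor ha, zero_mul, mul_zero]
  · rw [← zpow_neg, hfactor (neg_neg_of_pos ha), mul_zero, mul_zero]

theorem tprod_one_add_pow (hq : ‖q‖ < 1) : ∏' i : ℕ, (1 + q ^ (i + 1)) = J 2 q / J 1 q := by
  have hadd : Multipliable fun i : ℕ => 1 + q ^ (i + 1) := by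
    simpa using multipliable_one_sub_mul_pow hq (-1)
  have hsub : Multipliable fun i : ℕ => 1 - q ^ (i + 1) := by
    simpa using multipliable_one_sub_mul_pow hq 1
  rw [eq_div_iff (J_one_ne_zero hq)]
  simp only [J, one_mul]
  rw [← hadd.tprod_mul hsub]
  exact tprod_congr fun i => by ring

theorem hasSum_zpow_binom2 (hq0 : q ≠ 0) (hq : ‖q‖ < 1) :
    HasSum (fun n : ℕ => q ^ binom2 (n + 1)) (J 2 q ^ 2 / J 1 q) := by
  convert hasSum_zpow_binom2_mul_dirichletKernel hq0 hq (neg_ne_zero.2 one_ne_zero) using 1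
  · ext n
    rw [dirichletKernel_neg_one, mul_right_comm, ← mul_pow, neg_one_mul, neg_neg, one_pow, one_mul]
  · have hJ := J_one_ne_zero hq
    simp only [inv_neg_one, neg_one_mul, sub_neg_eq_add, tprod_one_add_pow hq]
    field_simp

end TripleProduct

noncomputable section Wedge

/-- The pairs `(n, j)` with `|j| ≤ n`, indexing both the Hecke-type double sum and the
Kac–Peterson sum of the theorem. -/
def wedge : Set (ℕ × ℤ) := {p | p.2 ∈ Icc (-(p.1 : ℤ)) p.1}

/-- The wedge as the disjoint union of its rows `n = const`. -/
def wedgeEquivSigma : wedge ≃ Σ n : ℕ, {j // j ∈ Icc (-(n : ℤ)) n} :=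
  Equiv.subtypeProdEquivSigmaSubtype fun (n : ℕ) (j : ℤ) => j ∈ Icc (-(n : ℤ)) n

/-- The common general term `(-1)^n q^{n (n + 1) - j (j + 1) / 2}` of the two double sums. -/
def wedgeTerm (q : ℂ) (p : ℕ × ℤ) : ℂ :=
  (-1) ^ p.1 * q ^ ((p.1 * (p.1 + 1) : ℤ) - binom2 (p.2 + 1))

/-- The map `a ↦ 2 a + j` followed by the folding `m ↦ max m (-1 - m)` of `ℤ` onto `ℕ`, which
preserves the triangular numbers `m (m + 1) / 2`. -/
def foldIndex (j a : ℤ) : ℕ := (max (2 * a + j) (-1 - (2 * a + j))).toNat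

variable {q : ℂ}

theorem mem_wedge {p : ℕ × ℤ} : p ∈ wedge ↔ -(p.1 : ℤ) ≤ p.2 ∧ p.2 ≤ p.1 := by
  simp only [wedge, Set.mem_ofPred_eq, mem_Icc]

theorem summable_wedge_of_nonneg {f : ℕ × ℤ → ℝ} (hf : ∀ p, 0 ≤ f p)
    (h : Summable fun n : ℕ => ∑ j ∈ Icc (-(n : ℤ)) n, f (n, j)) :
    Summable fun p : wedge => f p := by
  refine wedgeEquivSigma.symm.summable_iff.1 ((summable_sigma_of_nonneg fun x => hf _).2
    ⟨fun n => (hasSum_fintype _).summable, h.congr fun n => ?_⟩)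
  exact (Finset.tsum_subtype (Icc (-(n : ℤ)) n) fun j => f (n, j)).symm

theorem tsum_wedge {E : Type*} [NormedAddCommGroup E] [CompleteSpace E] {f : ℕ × ℤ → E}
    (hf : Summable fun p : wedge => f p) :
    ∑' p : wedge, f p = ∑' n : ℕ, ∑ j ∈ Icc (-(n : ℤ)) n, f (n, j) := by
  calc ∑' p : wedge, f p = ∑' x, f (wedgeEquivSigma.symm x).1 :=
      (wedgeEquivSigma.symm.tsum_eq fun p : wedge => f p).symm
    _ = ∑' (n : ℕ) (j : {j // j ∈ Icc (-(n : ℤ)) n}), f (n, j) :=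
      (wedgeEquivSigma.symm.summable_iff.2 hf).tsum_sigma
    _ = _ := tsum_congr fun n => Finset.tsum_subtype _ fun j => f (n, j)

theorem binom2_add_one_le_of_mem_wedge {p : ℕ × ℤ} (hp : p ∈ wedge) :
    binom2 (p.1 + 1) ≤ p.1 * (p.1 + 1) - binom2 (p.2 + 1) := by
  obtain ⟨hlower, hupper⟩ := mem_wedge.1 hp
  nlinarith [two_mul_binom2 (p.1 + 1), two_mul_binom2 (p.2 + 1)]

theorem summable_norm_wedgeTerm (hq0 : q ≠ 0) (hq : ‖q‖ < 1) :
    Summable fun p : wedge => ‖wedgeTerm q p‖ := by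
  have hq0' := norm_pos_iff.2 hq0
  have hmajorant : Summable fun p : wedge => ‖q‖ ^ binom2 (p.1.1 + 1) := by
    refine summable_wedge_of_nonneg (f := fun p => ‖q‖ ^ binom2 (p.1 + 1))
      (fun p => by positivity) ?_
    simpa only [dirichletKernel, one_zpow, mul_sum, mul_one] using
      summable_zpow_binom2_mul_dirichletKernel hq0' hq one_pos
  refine hmajorant.of_nonneg_of_le (fun p => norm_nonneg _) fun p => ?_
  simp only [wedgeTerm, norm_mul, norm_pow, norm_neg, norm_one, one_pow, one_mul, norm_zpow]
  exact zpow_le_zpow_right_of_le_one₀ hq0' hq.le (binom2_add_one_le_of_mem_wedge p.2)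

theorem foldIndex_bijective (j : ℤ) : Function.Bijective (foldIndex j) := by
  refine ⟨fun a b h => by simp only [foldIndex] at h; omega, fun n => ?_⟩
  rcases Int.even_or_odd' (n - j) with ⟨k, hk | hk⟩
  · exact ⟨k, by simp only [foldIndex]; omega⟩
  · exact ⟨-1 - k - j, by simp only [foldIndex]; omega⟩

theorem binom2_foldIndex_add_one (j a : ℤ) :
    binom2 (foldIndex j a + 1) = binom2 (2 * a + j + 1) := by
  rcases le_or_gt 0 (2 * a + j) with h | h
  · rw [show (foldIndex j a : ℤ) = 2 * a + j by simp only [foldIndex]; omega]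
  · rw [← binom2_neg]
    congr 1
    simp only [foldIndex]
    omega

theorem hasSum_zpow_binom2_two_mul_add (hq0 : q ≠ 0) (hq : ‖q‖ < 1) (j : ℤ) :
    HasSum (fun a : ℤ => q ^ binom2 (2 * a + j + 1)) (J 2 q ^ 2 / J 1 q) := by
  have h := (Equiv.ofBijective _ (foldIndex_bijective j)).hasSum_iff.2 (hasSum_zpow_binom2 hq0 hq)
  simpa only [Function.comp_def, Equiv.ofBijective_apply, binom2_foldIndex_add_one] using h

theorem summable_wedgeTerm_mul_zpow_binom2 (hq0 : q ≠ 0) (hq : ‖q‖ < 1) :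
    Summable (Function.uncurry fun (p : wedge) (a : ℤ) =>
      wedgeTerm q p * q ^ binom2 (2 * a + p.1.2 + 1)) := by
  have hinj : Function.Injective fun x : wedge × ℤ => (x.1, foldIndex x.1.1.2 x.2) := by
    rintro ⟨p, a⟩ ⟨p', a'⟩ h
    simp only [Prod.mk.injEq] at h
    obtain ⟨rfl, hfold⟩ := h
    rw [(foldIndex_bijective _).1 hfold]
  have h := (summable_mul_of_summable_norm (summable_norm_wedgeTerm hq0 hq)
    (hasSum_zpow_binom2 hq0 hq).summable.norm).comp_injective hinj
  simpa only [Function.comp_def, binom2_foldIndex_add_one] using! h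

theorem wedgeTerm_mul_zpow_binom2 (hq0 : q ≠ 0) (p : ℕ × ℤ) (a : ℤ) :
    wedgeTerm q p * q ^ binom2 (2 * a + p.2 + 1) =
      q ^ (a * (2 * a + 1)) *
        ((-1) ^ p.1 * (q ^ 2) ^ binom2 (p.1 + 1) * ((q ^ 2) ^ a) ^ p.2) := by
  have hexp : (p.1 * (p.1 + 1) : ℤ) - binom2 (p.2 + 1) + binom2 (2 * a + p.2 + 1) =
      a * (2 * a + 1) + (2 * binom2 (p.1 + 1) + 2 * a * p.2) := by
    linarith [two_mul_binom2 (p.1 + 1), two_mul_binom2 (p.2 + 1),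
      two_mul_binom2 (2 * a + p.2 + 1)]
  simp only [wedgeTerm, ← zpow_natCast q 2, ← zpow_mul]
  push_cast
  rw [mul_assoc, ← zpow_add₀ hq0, hexp, zpow_add₀ hq0, zpow_add₀ hq0]
  ring

theorem tsum_wedgeTerm_mul_zpow_binom2 (hq0 : q ≠ 0) (hq : ‖q‖ < 1) (a : ℤ) :
    ∑' p : wedge, wedgeTerm q p * q ^ binom2 (2 * a + p.1.2 + 1) =
      if a = 0 then J 2 q ^ 3 else 0 := by
  have hq0' := pow_ne_zero 2 hq0
  have hq' := norm_sq_lt_one hq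
  have hsum : Summable fun p : wedge => wedgeTerm q p * q ^ binom2 (2 * a + p.1.2 + 1) :=
    (summable_wedgeTerm_mul_zpow_binom2 hq0 hq).prod_symm.prod_factor a
  rw [tsum_wedge (f := fun p => wedgeTerm q p * q ^ binom2 (2 * a + p.2 + 1)) hsum]
  simp only [wedgeTerm_mul_zpow_binom2 hq0, ← mul_sum, tsum_mul_left,
    ← dirichletKernel.eq_def]
  split_ifs with ha
  · rw [ha, zpow_zero, (hasSum_zpow_binom2_mul_dirichletKernel_one hq0' hq').tsum_eq,
      zero_mul, zpow_zero, one_mul, J_eq_J_one_pow 2]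
  · rw [(hasSum_zpow_binom2_mul_dirichletKernel_zpow hq0' hq' ha).tsum_eq, mul_zero]

/-- Multiplying the `(n, j)`-th term by `∑ₐ q^{(2a + j)(2a + j + 1) / 2}`, whose value does not
depend on `j`, cancels the quadratic term in `j` and turns the sum over `j` into a Dirichlet
kernel. -/
theorem tsum_wedgeTerm (hq0 : q ≠ 0) (hq : ‖q‖ < 1) :
    ∑' p : wedge, wedgeTerm q p = J 1 q * J 2 q := by
  have hJ₁ := J_one_ne_zero hq
  have hJ₂ : J 2 q ≠ 0 := J_eq_J_one_pow 2 q ▸ J_one_ne_zero (norm_sq_lt_one hq)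
  have hmul : (∑' p : wedge, wedgeTerm q p) * (J 2 q ^ 2 / J 1 q) = J 2 q ^ 3 := calc
    _ = ∑' (p : wedge) (a : ℤ), wedgeTerm q p * q ^ binom2 (2 * a + p.1.2 + 1) := by
      rw [← tsum_mul_right]
      refine tsum_congr fun p => ?_
      rw [tsum_mul_left, (hasSum_zpow_binom2_two_mul_add hq0 hq p.1.2).tsum_eq]
    _ = ∑' (a : ℤ) (p : wedge), wedgeTerm q p * q ^ binom2 (2 * a + p.1.2 + 1) :=
      (summable_wedgeTerm_mul_zpow_binom2 hq0 hq).tsum_comm.symm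
    _ = J 2 q ^ 3 := by simp only [tsum_wedgeTerm_mul_zpow_binom2 hq0 hq, tsum_ite_eq]
  field_simp at hmul
  linear_combination hmul

end Wedge

noncomputable section HeckeSum

/-- The map `(r, s) ↦ (r + s, s)` on the first quadrant and `(r, s) ↦ (-1 - r - s, s)` on the
third. -/
def quadrantsToWedge : nonnegQuadrant ⊕ negQuadrant → wedge :=
  Sum.elim
    (fun ⟨(r, s), (⟨hr, hs⟩ : 0 ≤ r ∧ 0 ≤ s)⟩ =>
      ⟨((r + s).toNat, s), mem_wedge.2 (by dsimp only; omega)⟩)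
    (fun ⟨(r, s), (⟨hr, hs⟩ : r < 0 ∧ s < 0)⟩ =>
      ⟨((-1 - r - s).toNat, s), mem_wedge.2 (by dsimp only; omega)⟩)

variable {q : ℂ}

theorem quadrantsToWedge_bijective : Function.Bijective quadrantsToWedge := by
  refine ⟨fun x y h => ?_, ?_⟩
  · rcases x with ⟨⟨r, s⟩, hr, hs⟩ | ⟨⟨r, s⟩, hr, hs⟩ <;>
      rcases y with ⟨⟨r', s'⟩, hr', hs'⟩ | ⟨⟨r', s'⟩, hr', hs'⟩ <;>
      simp only [quadrantsToWedge, Sum.elim_inl, Sum.elim_inr, Subtype.ext_iff, Prod.mk.injEq,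
        Sum.inl.injEq, Sum.inr.injEq, reduceCtorEq] at h hr hs hr' hs' ⊢ <;>
      omega
  · rintro ⟨⟨n, j⟩, hp⟩
    obtain ⟨hlower, hupper⟩ := mem_wedge.1 hp
    rcases le_or_gt 0 j with hj | hj
    · refine ⟨Sum.inl ⟨(n - j, j), sub_nonneg.2 hupper, hj⟩, Subtype.ext (Prod.ext ?_ rfl)⟩
      change (n - j + j).toNat = n
      omega
    · refine ⟨Sum.inr ⟨(-1 - n - j, j), by dsimp only at hlower ⊢; omega, hj⟩,
        Subtype.ext (Prod.ext ?_ rfl)⟩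
      change (-1 - (-1 - n - j) - j).toNat = n
      omega

theorem heckeTerm_two_two_one (hq0 : q ≠ 0) (p : ℤ × ℤ) :
    heckeTerm 2 2 1 (q ^ 2) q q p =
      (-1) ^ (p.1 + p.2) * q ^ ((p.1 + p.2) * (p.1 + p.2 + 1) - binom2 (p.2 + 1)) := by
  rw [heckeTerm, ← zpow_natCast q 2, ← zpow_mul, mul_assoc, mul_assoc, ← zpow_add₀ hq0,
    ← zpow_add₀ hq0]
  congr 2
  push_cast
  linarith [two_mul_binom2 p.1, two_mul_binom2 p.2, two_mul_binom2 (p.2 + 1)]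

theorem wedgeTerm_quadrantsToWedge_inl (hq0 : q ≠ 0) (p : nonnegQuadrant) :
    wedgeTerm q (quadrantsToWedge (Sum.inl p)) = heckeTerm 2 2 1 (q ^ 2) q q p := by
  obtain ⟨⟨r, s⟩, hr, hs⟩ := p
  have hn : 0 ≤ r + s := add_nonneg hr hs
  rw [heckeTerm_two_two_one hq0, wedgeTerm, ← zpow_natCast]
  simp only [quadrantsToWedge, Sum.elim_inl, Int.toNat_of_nonneg hn]

theorem wedgeTerm_quadrantsToWedge_inr (hq0 : q ≠ 0) (p : negQuadrant) :
    wedgeTerm q (quadrantsToWedge (Sum.inr p)) = -heckeTerm 2 2 1 (q ^ 2) q q p := by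
  obtain ⟨⟨r, s⟩, hr, hs⟩ := p
  have hn : 0 ≤ -1 - r - s := by dsimp only at hr hs; omega
  have hsign (m : ℤ) : (-1 : ℂ) ^ (-1 - m) = -(-1) ^ m := by
    rw [zpow_sub₀ (by norm_num), zpow_neg_one, inv_neg_one, neg_div, one_div,
      ← inv_zpow, inv_neg_one]
  rw [heckeTerm_two_two_one hq0, wedgeTerm, ← zpow_natCast]
  simp only [quadrantsToWedge, Sum.elim_inr, Int.toNat_of_nonneg hn]
  rw [sub_sub, hsign, neg_mul]
  congr 3
  ring

theorem summable_wedgeTerm_quadrantsToWedge (hq0 : q ≠ 0) (hq : ‖q‖ < 1) :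
    Summable fun x => wedgeTerm q (quadrantsToWedge x) :=
  (summable_norm_wedgeTerm hq0 hq).of_norm.comp_injective quadrantsToWedge_bijective.1

theorem summable_heckeTerm_nonnegQuadrant (hq0 : q ≠ 0) (hq : ‖q‖ < 1) :
    Summable fun p : nonnegQuadrant => heckeTerm 2 2 1 (q ^ 2) q q p :=
  ((summable_wedgeTerm_quadrantsToWedge hq0 hq).comp_injective Sum.inl_injective).congr
    (wedgeTerm_quadrantsToWedge_inl hq0)

theorem summable_heckeTerm_negQuadrant (hq0 : q ≠ 0) (hq : ‖q‖ < 1) :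
    Summable fun p : negQuadrant => heckeTerm 2 2 1 (q ^ 2) q q p :=
  summable_neg_iff.1
    (((summable_wedgeTerm_quadrantsToWedge hq0 hq).comp_injective Sum.inr_injective).congr
      (wedgeTerm_quadrantsToWedge_inr hq0))

theorem heckeF_eq_tsum_wedgeTerm (hq0 : q ≠ 0) (hq : ‖q‖ < 1) :
    heckeF 2 2 1 (q ^ 2) q q = ∑' p : wedge, wedgeTerm q p := by
  have hnonneg := (summable_heckeTerm_nonnegQuadrant hq0 hq).hasSum
  have hneg := (summable_heckeTerm_negQuadrant hq0 hq).hasSum.neg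
  simp only [← wedgeTerm_quadrantsToWedge_inl hq0] at hnonneg
  simp only [← wedgeTerm_quadrantsToWedge_inr hq0] at hneg
  have hsum := hnonneg.sum (f := fun x => wedgeTerm q (quadrantsToWedge x)) hneg
  rw [← (Equiv.ofBijective _ quadrantsToWedge_bijective).tsum_eq]
  simp only [Equiv.ofBijective_apply]
  rw [hsum.tsum_eq, heckeF, sub_eq_add_neg]
  simp only [wedgeTerm_quadrantsToWedge_inl hq0]

end HeckeSum

noncomputable section KacPeterson

/-- The point of the Kac–Peterson plane with `|x| = (2 n + 1) / 4` and `y = (2 j + 1) / 4`; the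
sign of `x` is the one that puts `x` in `1 / 4 + ℤ`. -/
def kpPoint (p : ℕ × ℤ) : ℝ × ℝ := ((-1) ^ p.1 * ((2 * p.1 + 1) / 4), (2 * p.2 + 1) / 4)

theorem abs_kpPoint_fst (p : ℕ × ℤ) : |(kpPoint p).1| = (2 * p.1 + 1) / 4 := by
  rw [kpPoint, abs_mul, abs_pow, abs_neg, abs_one, one_pow, one_mul, abs_of_pos (by positivity)]

theorem kpPoint_injective : Function.Injective kpPoint := by
  intro p p' h
  have hfst : ((2 * p.1 + 1) / 4 : ℝ) = (2 * p'.1 + 1) / 4 := by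
    rw [← abs_kpPoint_fst, ← abs_kpPoint_fst, h]
  have hsnd : ((2 * p.2 + 1) / 4 : ℝ) = (2 * p'.2 + 1) / 4 := congrArg Prod.snd h
  refine Prod.ext (Nat.cast_injective (R := ℝ) ?_) (Int.cast_injective (α := ℝ) ?_) <;> linarith

theorem kpPoint_bounds_iff (p : ℕ × ℤ) :
    -|(kpPoint p).1| < (kpPoint p).2 ∧ (kpPoint p).2 ≤ |(kpPoint p).1| ↔ p ∈ wedge := by
  have hlower : -|(kpPoint p).1| < (kpPoint p).2 ↔ -(p.1 : ℤ) - 1 < p.2 := by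
    rw [abs_kpPoint_fst, ← Int.cast_lt (R := ℝ), kpPoint]
    push_cast
    constructor <;> intro h <;> linarith
  have hupper : (kpPoint p).2 ≤ |(kpPoint p).1| ↔ p.2 ≤ p.1 := by
    rw [abs_kpPoint_fst, ← Int.cast_le (R := ℝ), kpPoint]
    push_cast
    constructor <;> intro h <;> linarith
  rw [hlower, hupper, mem_wedge]
  omega

theorem exists_eq_quarter_add_int_iff (x : ℝ) :
    (∃ a : ℤ, x = 1 / 4 + a) ↔ ∃ n : ℕ, x = (-1) ^ n * ((2 * n + 1) / 4) := by
  constructor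
  · rintro ⟨a, rfl⟩
    rcases le_or_gt 0 a with ha | ha
    · lift a to ℕ using ha
      exact ⟨2 * a, by rw [pow_mul]; push_cast; norm_num; ring⟩
    · obtain ⟨m, rfl⟩ : ∃ m : ℕ, a = -m - 1 := ⟨(-a - 1).toNat, by omega⟩
      exact ⟨2 * m + 1, by rw [pow_succ, pow_mul]; push_cast; norm_num; ring⟩
  · rintro ⟨n, rfl⟩
    rcases Nat.even_or_odd' n with ⟨m, rfl | rfl⟩
    · exact ⟨m, by rw [pow_mul]; push_cast; norm_num; ring⟩
    · exact ⟨-m - 1, by rw [pow_succ, pow_mul]; push_cast; norm_num; ring⟩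

theorem inShiftedLattice_or_reflection_iff (x y : ℝ) :
    inShiftedLattice 2 1 1 x y ∨ inShiftedLattice 2 1 1 (1 / 2 - x) (1 / 2 + y) ↔
      (∃ a : ℤ, x = 1 / 4 + a) ∧ ∃ j : ℤ, y = (2 * j + 1) / 4 := by
  constructor
  · rintro (⟨a, b, hx, hy⟩ | ⟨a, b, hx, hy⟩) <;> push_cast at hx hy
    · exact ⟨⟨a, by linarith⟩, 2 * b, by push_cast; linarith⟩
    · exact ⟨⟨-a, by push_cast; linarith⟩, 2 * b - 1, by push_cast; linarith⟩
  · rintro ⟨⟨a, rfl⟩, j, rfl⟩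
    rcases Int.even_or_odd' j with ⟨b, rfl | rfl⟩
    · exact Or.inl ⟨a, b, by norm_num, by push_cast; ring⟩
    · exact Or.inr ⟨-a, b + 1, by push_cast; ring, by push_cast; ring⟩

theorem image_kpPoint_wedge : kpPoint '' wedge = kpIndex 2 1 1 := by
  ext ⟨x, y⟩
  constructor
  · rintro ⟨p, hp, hpoint⟩
    obtain ⟨hlower, hupper⟩ := (kpPoint_bounds_iff p).2 hp
    rw [← hpoint]
    exact ⟨hlower, hupper, (inShiftedLattice_or_reflection_iff _ _).2
      ⟨(exists_eq_quarter_add_int_iff _).2 ⟨p.1, rfl⟩, p.2, rfl⟩⟩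
  · rintro ⟨hlower, hupper, hlattice⟩
    obtain ⟨hx, j, rfl⟩ := (inShiftedLattice_or_reflection_iff x y).1 hlattice
    obtain ⟨n, rfl⟩ := (exists_eq_quarter_add_int_iff x).1 hx
    exact ⟨(n, j), (kpPoint_bounds_iff (n, j)).1 ⟨hlower, hupper⟩, rfl⟩

theorem sg_kpPoint (p : ℕ × ℤ) : sg (kpPoint p).1 = (-1) ^ p.1 := by
  have hpos : (0 : ℝ) < (2 * p.1 + 1) / 4 := by positivity
  rcases Nat.even_or_odd p.1 with h | h
  · simp only [sg, kpPoint, h.neg_one_pow, one_mul, if_pos hpos.le]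
  · simp only [sg, kpPoint, h.neg_one_pow, neg_one_mul]
    rw [if_neg (by linarith)]

theorem nome_ne_zero (τ : ℂ) : nome τ ≠ 0 := Complex.exp_ne_zero _

theorem norm_nome_lt_one (τ : ℍ) : ‖nome τ‖ < 1 := norm_exp_two_pi_I_lt_one τ

theorem nome_zpow (τ : ℂ) (n : ℤ) :
    nome τ ^ n = Complex.exp (2 * Real.pi * Complex.I * τ * n) := by
  rw [nome, ← Complex.exp_int_mul, mul_comm]

theorem kpTerm_kpPoint (τ : ℂ) (p : ℕ × ℤ) :
    kpTerm 2 τ (kpPoint p) =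
      Complex.exp (2 * Real.pi * Complex.I * τ / 8) * wedgeTerm (nome τ) p := by
  have hexp : (((2 : ℕ) : ℝ) + 2) * (kpPoint p).1 ^ 2 - ((2 : ℕ) : ℝ) * (kpPoint p).2 ^ 2 =
      1 / 8 + (p.1 * (p.1 + 1) - binom2 (p.2 + 1) : ℤ) := by
    have hbinom : (2 * binom2 (p.2 + 1) : ℝ) = (p.2 + 1) * p.2 := by
      have h := two_mul_binom2 (p.2 + 1)
      rw [add_sub_cancel_right] at h
      exact_mod_cast h
    rw [← sq_abs, abs_kpPoint_fst, kpPoint]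
    push_cast
    linear_combination hbinom / 2
  rw [kpTerm, sg_kpPoint, hexp, wedgeTerm, nome_zpow, mul_left_comm, ← Complex.exp_add]
  push_cast
  ring_nf

theorem hasSum_kpTerm (τ : ℍ) :
    HasSum (fun p : kpIndex 2 1 1 => kpTerm 2 τ p)
      (Complex.exp (2 * Real.pi * Complex.I * τ / 8) *
        heckeF 2 2 1 (nome τ ^ 2) (nome τ) (nome τ)) := by
  have hq0 := nome_ne_zero τ
  have hq := norm_nome_lt_one τ
  rw [← image_kpPoint_wedge, heckeF_eq_tsum_wedgeTerm hq0 hq]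
  refine (Equiv.Set.image kpPoint wedge kpPoint_injective).hasSum_iff.1 ?_
  simpa only [Function.comp_def, Equiv.Set.image_apply, kpTerm_kpPoint] using
    (summable_norm_wedgeTerm hq0 hq).of_norm.hasSum.mul_left _

theorem eta_eq_exp_mul_J (τ : ℂ) :
    ModularForm.eta τ = Complex.exp (2 * Real.pi * Complex.I * τ / 24) * J 1 (nome τ) := by
  simp only [ModularForm.eta, J, ModularForm.eta_q_eq_pow, nome, one_mul,
    Function.Periodic.qParam]
  norm_num

theorem nome_two_mul (τ : ℂ) : nome (2 * τ) = nome τ ^ 2 := by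
  rw [nome, nome, ← Complex.exp_nat_mul, Nat.cast_ofNat, mul_left_comm]

theorem eta_mul_eta_two_mul (τ : ℂ) : ModularForm.eta τ * ModularForm.eta (2 * τ) =
    Complex.exp (2 * Real.pi * Complex.I * τ / 8) * (J 1 (nome τ) * J 2 (nome τ)) := by
  rw [eta_eq_exp_mul_J, eta_eq_exp_mul_J, nome_two_mul, ← J_eq_J_one_pow, mul_mul_mul_comm,
    ← Complex.exp_add]
  congr 2
  ring

end KacPeterson

end HeckeString

theorem mainTheorem7 (τ : ℍ) :
    -- the double sum converges absolutely, and `f_{2,2,1}(q², q, q) = J₁ J₂`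
    (Summable (fun p : HeckeString.nonnegQuadrant =>
        HeckeString.heckeTerm 2 2 1 (HeckeString.nome τ ^ 2) (HeckeString.nome τ)
          (HeckeString.nome τ) p) ∧
      Summable (fun p : HeckeString.negQuadrant =>
        HeckeString.heckeTerm 2 2 1 (HeckeString.nome τ ^ 2) (HeckeString.nome τ)
          (HeckeString.nome τ) p) ∧
      HeckeString.heckeF 2 2 1 (HeckeString.nome τ ^ 2) (HeckeString.nome τ)
          (HeckeString.nome τ) =
        HeckeString.J 1 (HeckeString.nome τ) * HeckeString.J 2 (HeckeString.nome τ)) ∧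
    -- the relation `η(τ)³ c₁₁¹¹ = q^{1/8} f_{2,2,1}(q², q, q)` behind the equivalence
    (Summable (fun p : HeckeString.kpIndex 2 1 1 => HeckeString.kpTerm 2 τ p) ∧
      ModularForm.eta τ ^ 3 * HeckeString.stringFunction 2 1 1 τ =
        Complex.exp (2 * Real.pi * Complex.I * τ / 8) *
          HeckeString.heckeF 2 2 1 (HeckeString.nome τ ^ 2) (HeckeString.nome τ)
            (HeckeString.nome τ)) ∧
    -- the string function evaluation `c₁₁¹¹ = η(τ)⁻² η(2τ)`
    HeckeString.stringFunction 2 1 1 τ =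
      (ModularForm.eta τ ^ 2)⁻¹ * ModularForm.eta (2 * (τ : ℂ)) := by
  have hq0 := HeckeString.nome_ne_zero τ
  have hq := HeckeString.norm_nome_lt_one τ
  have hη : ModularForm.eta τ ≠ 0 := ModularForm.eta_ne_zero τ.2
  have hf := (HeckeString.heckeF_eq_tsum_wedgeTerm hq0 hq).trans (HeckeString.tsum_wedgeTerm hq0 hq)
  have hkp := HeckeString.hasSum_kpTerm τ
  have hc : ModularForm.eta τ ^ 3 * HeckeString.stringFunction 2 1 1 τ =
      Complex.exp (2 * Real.pi * Complex.I * τ / 8) *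
        HeckeString.heckeF 2 2 1 (HeckeString.nome τ ^ 2) (HeckeString.nome τ)
          (HeckeString.nome τ) := by
    rw [HeckeString.stringFunction, mul_inv_cancel_left₀ (pow_ne_zero 3 hη), hkp.tsum_eq]
  refine ⟨⟨HeckeString.summable_heckeTerm_nonnegQuadrant hq0 hq,
    HeckeString.summable_heckeTerm_negQuadrant hq0 hq, hf⟩, ⟨hkp.summable, hc⟩, ?_⟩
  refine mul_left_cancel₀ (pow_ne_zero 3 hη) ?_
  rw [hc, hf, ← HeckeString.eta_mul_eta_two_mul]
  field_simp
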